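/- Let $(M,g)$ be a (finite-dimensional, smooth) Riemannian manifold without boundary and let $f\in C^\infty(M)$ satisfy $\|\operatorname{grad} f\|<1$ on $M$, where the gradient and its norm are taken with respect to $g$; then $\tilde g=g-df\otimes df$ is again a Riemannian metric on $M$. Recall that a smooth map $\varphi:(M,g)\to(N,h)$ between Riemannian manifolds is called harmonic if its tension field $$\tau(\varphi)=\operatorname{trace}_g\nabla d\varphi=\sum_{i=1}^m\left[\nabla^{\varphi}_{e_i}d\varphi(e_i)-d\varphi(\nabla^{M}_{e_i}e_i)\right]$$ vanishes identically, where $\{e_i\}_{i=1}^m$ is a local orthonormal frame on $(M,g)$, $\nabla^M$ is the Levi-Civita connection of $(M,g)$, and $\nabla^\varphi$ is the pull-back to $\varphi^{-1}TN$ of the Levi-Civita connection of $(N,h)$; and that $f$ is harmonic on $(M,g)$ if $\Delta f=\operatorname{trace}_g\operatorname{Hess}_f=0$ on $M$. Then the identity map $$\tilde I_c:(M,g)\to(M,\tilde g),\qquad x\mapsto x,$$ is a harmonic map if and only if $f$ is a harmonic function on $(M,g)$. -/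

import Mathlib

open Bundle
open scoped Manifold ContDiff Topology

noncomputable section

/-! ### Calculus in an open subset of a finite-dimensional real vector space -/

section Local

variable {E : Type*} [NormedAddCommGroup E] [NormedSpace ℝ E]
  {F : Type*} [NormedAddCommGroup F] [NormedSpace ℝ F]

/-- The Christoffel symbols of the first kind of a field `G` of bilinear forms, as the covector
`w ↦ (1/2) (∂_u G(v, w) + ∂_v G(u, w) - ∂_w G(u, v))` at the point `y`. -/
def christoffelFirst (G : E → E →L[ℝ] E →L[ℝ] ℝ) (y u v : E) : E →L[ℝ] ℝ :=
  (1 / 2 : ℝ) • (fderiv ℝ G y u v + fderiv ℝ G y v u - ((fderiv ℝ G y).flip u).flip v)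

/-- The Christoffel symbols (of the second kind) of a field `G` of inner products: `Γ(u, v)` is the
vector with `G(Γ(u, v), w) = (1/2) (∂_u G(v, w) + ∂_v G(u, w) - ∂_w G(u, v))` for all `w`,
that is `Γ(∂_i, ∂_j) = Γ_{ij}^k ∂_k`. -/
def christoffel (G : E → E →L[ℝ] E →L[ℝ] ℝ) (y u v : E) : E :=
  (G y).inverse (christoffelFirst G y u v)

/-- The trace `G^{ij} B(b_i, b_j)` of `B` with respect to the inner product `G`, where `b` is a
basis of `E` (its choice does not matter) and `G^{ij}` is the inverse of the Gram matrix
`G(b_i, b_j)`. -/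
def metricTrace [FiniteDimensional ℝ E] (G : E →L[ℝ] E →L[ℝ] ℝ) (B : E → E → F) : F :=
  let b := Module.finBasis ℝ E
  ∑ i, ∑ j, (Matrix.of fun k l ↦ G (b k) (b l))⁻¹ i j • B (b i) (b j)

/-- The Hessian `∇df (u, v)` of a function `f` with respect to the Levi-Civita connection of `G`:
`∂_i ∂_j f - Γ_{ij}^k ∂_k f`. -/
def localHessian (G : E → E →L[ℝ] E →L[ℝ] ℝ) (f : E → ℝ) (y u v : E) : ℝ :=
  fderiv ℝ (fderiv ℝ f) y u v - fderiv ℝ f y (christoffel G y u v)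

/-- The second fundamental form `∇dφ (u, v) = ∇^φ_u dφ(v) - dφ(∇_u v)` of a map between open sets
with metrics `G` and `K`, where `∇^φ` is the pull-back of the Levi-Civita connection of `K`:
in coordinates
`∂_i ∂_j φ^γ + Γ^K_{αβ}^γ(φ) ∂_i φ^α ∂_j φ^β - Γ^G_{ij}^k ∂_k φ^γ`. -/
def localSecondFundamentalForm (G : E → E →L[ℝ] E →L[ℝ] ℝ) (K : F → F →L[ℝ] F →L[ℝ] ℝ)
    (φ : E → F) (y u v : E) : F :=
  fderiv ℝ (fderiv ℝ φ) y u v + christoffel K (φ y) (fderiv ℝ φ y u) (fderiv ℝ φ y v)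
    - fderiv ℝ φ y (christoffel G y u v)

end Local

/-! ### Riemannian manifolds -/

section Manifold

variable {E : Type*} [NormedAddCommGroup E] [NormedSpace ℝ E]
  {M : Type*} [TopologicalSpace M] [ChartedSpace E M] [IsManifold 𝓘(ℝ, E) ∞ M]
  {F : Type*} [NormedAddCommGroup F] [NormedSpace ℝ F]
  {N : Type*} [TopologicalSpace N] [ChartedSpace F N] [IsManifold 𝓘(ℝ, F) ∞ N]

/-- Smooth Riemannian metrics on the manifold `M` (without boundary, modelled on `E`). -/
abbrev RiemMetric (E : Type*) [NormedAddCommGroup E] [NormedSpace ℝ E]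
    (M : Type*) [TopologicalSpace M] [ChartedSpace E M] [IsManifold 𝓘(ℝ, E) ∞ M] :=
  ContMDiffRiemannianMetric 𝓘(ℝ, E) ∞ E (TangentSpace 𝓘(ℝ, E) : M → Type _)

/-- The differential of a function, as a covector at `x`. -/
def differential (f : M → ℝ) (x : M) : TangentSpace 𝓘(ℝ, E) x →L[ℝ] ℝ :=
  mfderiv 𝓘(ℝ, E) 𝓘(ℝ, ℝ) f x

/-- The expression of a Riemannian metric in the chart `e`, that is the pull-back of the metric by
the inverse of `e`. -/
def metricInChart (g : RiemMetric E M) (e : OpenPartialHomeomorph M E) (y : E) :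
    E →L[ℝ] E →L[ℝ] ℝ :=
  let A : E →L[ℝ] E := mfderiv 𝓘(ℝ, E) 𝓘(ℝ, E) e.symm y
  let G : E →L[ℝ] E →L[ℝ] ℝ := g.inner (e.symm y)
  G.bilinearComp A A

/-- The expression, in the charts `e` and `e'`, of the tension field `τ(φ) = trace_g ∇dφ` at the
point `x`. -/
def tensionField [FiniteDimensional ℝ E] (g : RiemMetric E M) (h : RiemMetric F N) (φ : M → N)
    (e : OpenPartialHomeomorph M E) (e' : OpenPartialHomeomorph N F) (x : M) : F :=
  metricTrace (metricInChart g e (e x))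
    (localSecondFundamentalForm (metricInChart g e) (metricInChart h e') (e' ∘ φ ∘ e.symm) (e x))

/-- A smooth map between Riemannian manifolds is harmonic if its tension field vanishes at every
point, in all local coordinates. -/
def IsHarmonicMap [FiniteDimensional ℝ E] (g : RiemMetric E M) (h : RiemMetric F N)
    (φ : C^∞⟮𝓘(ℝ, E), M; 𝓘(ℝ, F), N⟯) : Prop :=
  ∀ e ∈ IsManifold.maximalAtlas 𝓘(ℝ, E) ∞ M, ∀ e' ∈ IsManifold.maximalAtlas 𝓘(ℝ, F) ∞ N,
    ∀ x ∈ e.source, φ x ∈ e'.source → tensionField g h φ e e' x = 0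

/-- The Laplacian `Δf = trace_g Hess f` at the point `x`, computed in the chart `e`. -/
def laplaceBeltrami [FiniteDimensional ℝ E] (g : RiemMetric E M) (f : M → ℝ)
    (e : OpenPartialHomeomorph M E) (x : M) : ℝ :=
  metricTrace (metricInChart g e (e x)) (localHessian (metricInChart g e) (f ∘ e.symm) (e x))

/-- A smooth function on a Riemannian manifold is harmonic if its Laplacian vanishes at every
point, in all local coordinates. -/
def IsHarmonicFunction [FiniteDimensional ℝ E] (g : RiemMetric E M)
    (f : C^∞⟮𝓘(ℝ, E), M; 𝓘(ℝ, ℝ), ℝ⟯) : Prop :=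
  ∀ e ∈ IsManifold.maximalAtlas 𝓘(ℝ, E) ∞ M, ∀ x ∈ e.source, laplaceBeltrami g f e x = 0

/-- The gradient of `f`: the vector field with `g(grad f, v) = df(v)`, see `inner_gradient`. -/
def riemGradient (g : RiemMetric E M) (f : M → ℝ) (x : M) : TangentSpace 𝓘(ℝ, E) x :=
  (g.inner x).inverse (differential f x)

/-- The norm `‖grad f‖ = √(g(grad f, grad f))`. -/
def gradientNorm (g : RiemMetric E M) (f : M → ℝ) (x : M) : ℝ :=
  √(g.inner x (riemGradient g f x) (riemGradient g f x))

theorem inner_gradient [FiniteDimensional ℝ E] (g : RiemMetric E M) (f : M → ℝ) (x : M)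
    (v : TangentSpace 𝓘(ℝ, E) x) :
    g.inner x (riemGradient g f x) v = differential f x v := by
  let G : E →L[ℝ] E →L[ℝ] ℝ := g.inner x
  have hinj : Function.Injective (G : E →ₗ[ℝ] E →L[ℝ] ℝ) := by
    rw [← LinearMap.ker_eq_bot, LinearMap.ker_eq_bot']
    intro m hm
    by_contra hne
    have h1 := g.pos x m hne
    have h2 : G m m = 0 := by
      have : G m = 0 := hm
      rw [this]; rfl
    exact h1.ne' h2
  have hd : Module.finrank ℝ E = Module.finrank ℝ (E →L[ℝ] ℝ) := by
    rw [← LinearEquiv.finrank_eq (LinearMap.toContinuousLinearMap (𝕜 := ℝ) (E := E) (F' := ℝ))]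
    exact (Subspace.dual_finrank_eq (K := ℝ) (V := E)).symm
  let L : E ≃L[ℝ] (E →L[ℝ] ℝ) :=
    (LinearEquiv.ofInjectiveOfFinrankEq (G : E →ₗ[ℝ] E →L[ℝ] ℝ) hinj hd).toContinuousLinearEquiv
  have hL : (L : E →L[ℝ] E →L[ℝ] ℝ) = G := by
    ext u w; rfl
  let d : E →L[ℝ] ℝ := differential f x
  have key : G (G.inverse d) = d := by
    rw [← hL, ContinuousLinearMap.inverse_equiv]
    exact L.apply_symm_apply d
  exact congrArg (fun k : E →L[ℝ] ℝ ↦ k v) key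

/-- The bilinear form `g - df ⊗ df` at the point `x`. -/
def deformedInner (g : RiemMetric E M) (f : M → ℝ) (x : M) :
    TangentSpace 𝓘(ℝ, E) x →L[ℝ] TangentSpace 𝓘(ℝ, E) x →L[ℝ] ℝ :=
  g.inner x - (differential f x).smulRight (differential f x)

theorem deformedInner_apply (g : RiemMetric E M) (f : M → ℝ) (x : M)
    (u v : TangentSpace 𝓘(ℝ, E) x) :
    deformedInner g f x u v = g.inner x u v - differential f x u * differential f x v := rfl

theorem differential_sq_le [FiniteDimensional ℝ E] (g : RiemMetric E M) (f : M → ℝ) (x : M)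
    (v : TangentSpace 𝓘(ℝ, E) x) :
    differential f x v * differential f x v ≤ gradientNorm g f x ^ 2 * g.inner x v v := by
  have hnn : ∀ w : TangentSpace 𝓘(ℝ, E) x, 0 ≤ g.inner x w w := fun w ↦ by
    rcases eq_or_ne w 0 with rfl | hw
    · simp
    · exact (g.pos x w hw).le
  rw [gradientNorm, Real.sq_sqrt (hnn _), ← inner_gradient g f x v]
  generalize riemGradient g f x = a
  have h := hnn (g.inner x a a • v - g.inner x a v • a)
  simp only [map_sub, map_smul, sub_apply, smul_apply,
    smul_eq_mul, g.symm x v a] at h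
  rcases eq_or_ne a 0 with rfl | ha
  · simp
  · have hpos := g.pos x a ha
    nlinarith

theorem deformedInner_ge [FiniteDimensional ℝ E] (g : RiemMetric E M) (f : M → ℝ) (x : M)
    (v : TangentSpace 𝓘(ℝ, E) x) :
    (1 - gradientNorm g f x ^ 2) * g.inner x v v ≤ deformedInner g f x v v := by
  rw [deformedInner_apply]
  linarith [differential_sq_le g f x v]

theorem one_sub_gradientNorm_pos (g : RiemMetric E M) (f : M → ℝ) (x : M)
    (hf : gradientNorm g f x < 1) : 0 < 1 - gradientNorm g f x ^ 2 := by
  have h0 : 0 ≤ gradientNorm g f x := Real.sqrt_nonneg _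
  nlinarith

theorem deformedInner_pos [FiniteDimensional ℝ E] (g : RiemMetric E M) (f : M → ℝ) (x : M)
    (hf : gradientNorm g f x < 1) (v : TangentSpace 𝓘(ℝ, E) x) (hv : v ≠ 0) :
    0 < deformedInner g f x v v :=
  (mul_pos (one_sub_gradientNorm_pos g f x hf) (g.pos x v hv)).trans_le (deformedInner_ge g f x v)

theorem deformedInner_isVonNBounded [FiniteDimensional ℝ E] (g : RiemMetric E M) (f : M → ℝ)
    (x : M) (hf : gradientNorm g f x < 1) :
    Bornology.IsVonNBounded ℝ {v : TangentSpace 𝓘(ℝ, E) x | deformedInner g f x v v < 1} := by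
  have hc := one_sub_gradientNorm_pos g f x hf
  set c := 1 - gradientNorm g f x ^ 2 with hcdef
  have hs : 0 < √c := Real.sqrt_pos.2 hc
  have hss : √c * √c = c := Real.mul_self_sqrt hc.le
  refine ((g.isVonNBounded x).image
    ((√c)⁻¹ • ContinuousLinearMap.id ℝ (TangentSpace 𝓘(ℝ, E) x))).subset ?_
  intro v hv
  refine ⟨√c • v, ?_, ?_⟩
  · have h := (deformedInner_ge g f x v).trans_lt hv
    simp only [Set.mem_ofPred_eq, map_smul, smul_apply, smul_eq_mul]
    rw [← mul_assoc, hss]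
    exact h
  · simp [smul_smul, hs.ne']

theorem contMDiff_deformedInner (g : RiemMetric E M) (f : C^∞⟮𝓘(ℝ, E), M; 𝓘(ℝ, ℝ), ℝ⟯) :
    ContMDiff 𝓘(ℝ, E) (𝓘(ℝ, E).prod 𝓘(ℝ, E →L[ℝ] E →L[ℝ] ℝ)) ∞
      (fun x ↦ TotalSpace.mk' (E →L[ℝ] E →L[ℝ] ℝ)
        (E := fun x : M ↦ TangentSpace 𝓘(ℝ, E) x →L[ℝ] TangentSpace 𝓘(ℝ, E) x →L[ℝ] ℝ)
        x (deformedInner g f x)) := by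
  intro x₀
  have hg := g.contMDiff x₀
  rw [contMDiffAt_section] at hg ⊢
  have hd := (f.contMDiff x₀).mfderiv_const (m := ∞) (by simp)
  let D : M → E →L[ℝ] ℝ :=
    inTangentCoordinates 𝓘(ℝ, E) 𝓘(ℝ, ℝ) id f (mfderiv 𝓘(ℝ, E) 𝓘(ℝ, ℝ) f) x₀
  have hsq : ContDiff ℝ ∞ (fun L : E →L[ℝ] ℝ ↦ L.smulRight L) := by
    exact contDiff_id.smulRight contDiff_id
  have h2 : ContMDiffAt 𝓘(ℝ, E) 𝓘(ℝ, E →L[ℝ] E →L[ℝ] ℝ) ∞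
      (fun x ↦ (D x).smulRight (D x)) x₀ :=
    hsq.contMDiff.contMDiffAt.comp x₀ (f := D) hd
  refine (hg.sub h2).congr_of_eventuallyEq ?_
  filter_upwards [(trivializationAt E (TangentSpace 𝓘(ℝ, E)) x₀).open_baseSet.mem_nhds
    (FiberBundle.mem_baseSet_trivializationAt' x₀)] with x hx
  ext u v
  have hDx : ∀ w, D x w = differential f x
      ((trivializationAt E (TangentSpace 𝓘(ℝ, E)) x₀).symm x w) := by
    intro w
    have h := TangentBundle.continuousLinearMapAt_model_space (𝕜 := ℝ) (F := ℝ) (f x₀) (f x)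
    simp only [D, inTangentCoordinates, ContinuousLinearMap.inCoordinates, id]
    rw [h]
    have h' := Bundle.Trivialization.symmL_apply (R := ℝ)
      (trivializationAt E (TangentSpace 𝓘(ℝ, E)) x₀) hx w
    rw [← h']
    rfl
  simp only [hom_trivializationAt_apply, sub_apply, ContinuousLinearMap.smulRight_apply]
  rw [inCoordinates_apply_eq₂ hx hx (by simp), inCoordinates_apply_eq₂ hx hx (by simp)]
  simp [deformedInner_apply, hDx]

/-- The Riemannian metric `g - df ⊗ df`, for a smooth function `f` with `‖grad f‖ < 1`. -/
def deformedMetric [FiniteDimensional ℝ E] (g : RiemMetric E M)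
    (f : C^∞⟮𝓘(ℝ, E), M; 𝓘(ℝ, ℝ), ℝ⟯) (hf : ∀ x, gradientNorm g f x < 1) : RiemMetric E M where
  inner x := deformedInner g f x
  symm x u v := by rw [deformedInner_apply, deformedInner_apply, g.symm x u v, mul_comm]
  pos x v hv := deformedInner_pos g f x (hf x) v hv
  isVonNBounded x := deformedInner_isVonNBounded g f x (hf x)
  contMDiff := contMDiff_deformedInner g f

end Manifold

end

/-! Write g̃ = g - df ⊗ df. In one chart the tension field of the identity is the g-trace of the
difference Γ̃ - Γ of the Christoffel symbols. Lowering the index with g̃ avoids inverting g - df ⊗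
df. By the symmetry of D²f, the first-kind symbols of g̃ are those of g minus D²f(u, v) df.
Subtracting g̃(Γ(u, v), w) = g(Γ(u, v), w) - df(Γ(u, v)) df(w) gives g̃(Γ̃(u, v) - Γ(u, v), w) =
-Hess f(u, v) df(w), and the trace is g̃(τ, ·) = -Δf df.

If Δf = 0, then τ = 0 because g̃ is positive definite. If τ = 0, then at each point Δf = 0 or df =
0. Were Δf nonzero at a point, it would be nonzero nearby by continuity, so df would vanish nearby
and Hess f, hence Δf, would vanish at the point.

With different charts on source and target, the identity reads as a transition map φ, an isometry
between the two expressions of g̃. The pullback law `christoffelFirst_pullback` absorbs D²φ, and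
`apply_localSecondFundamentalForm_deformed` gives the same formula tested on vectors dφ(w). The
passage to manifolds is `metricInChart_tensionField_id`; the continuity argument is
`metricTrace_localHessian_eq_zero`. -/

/-! ### Christoffel symbols and second fundamental forms in a vector space -/

section Local

set_option maxSynthPendingDepth 3

variable {E : Type*} [NormedAddCommGroup E] [NormedSpace ℝ E]
  {F : Type*} [NormedAddCommGroup F] [NormedSpace ℝ F]
  {H : Type*} [NormedAddCommGroup H] [NormedSpace ℝ H]

/-- A positive definite form on a finite-dimensional space is an isomorphism onto the dual. -/
theorem exists_equiv_dual_of_pos [FiniteDimensional ℝ E] {G : E →L[ℝ] E →L[ℝ] ℝ}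
    (hG : ∀ v, v ≠ 0 → 0 < G v v) : ∃ L : E ≃L[ℝ] (E →L[ℝ] ℝ), (L : E →L[ℝ] E →L[ℝ] ℝ) = G := by
  have hinj : Function.Injective (G : E →ₗ[ℝ] E →L[ℝ] ℝ) := by
    rw [← LinearMap.ker_eq_bot, LinearMap.ker_eq_bot']
    intro m hm
    by_contra hne
    have h1 := hG m hne
    have h2 : G m = 0 := hm
    simp [h2] at h1
  have hd : Module.finrank ℝ E = Module.finrank ℝ (E →L[ℝ] ℝ) := by
    rw [← LinearEquiv.finrank_eq (LinearMap.toContinuousLinearMap (𝕜 := ℝ) (E := E) (F' := ℝ))]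
    exact (Subspace.dual_finrank_eq (K := ℝ) (V := E)).symm
  exact ⟨(LinearEquiv.ofInjectiveOfFinrankEq (G : E →ₗ[ℝ] E →L[ℝ] ℝ) hinj
    hd).toContinuousLinearEquiv, by ext u w; rfl⟩

/-- `ContinuousLinearMap.inverse` takes the default value zero on non-invertible maps; positivity
makes it the true inverse. -/
theorem apply_inverse_of_pos [FiniteDimensional ℝ E] {G : E →L[ℝ] E →L[ℝ] ℝ}
    (hG : ∀ v, v ≠ 0 → 0 < G v v) (d : E →L[ℝ] ℝ) : G (G.inverse d) = d := by
  obtain ⟨L, rfl⟩ := exists_equiv_dual_of_pos hG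
  rw [ContinuousLinearMap.inverse_equiv]
  exact L.apply_symm_apply d

theorem apply_christoffel [FiniteDimensional ℝ E] {G : E → E →L[ℝ] E →L[ℝ] ℝ} {y : E}
    (hG : ∀ v, v ≠ 0 → 0 < G y v v) (u v : E) :
    G y (christoffel G y u v) = christoffelFirst G y u v :=
  apply_inverse_of_pos hG _

theorem christoffelFirst_apply (G : E → E →L[ℝ] E →L[ℝ] ℝ) (y u v w : E) :
    christoffelFirst G y u v w
      = (1 / 2) * (fderiv ℝ G y u v w + fderiv ℝ G y v u w - fderiv ℝ G y w u v) := by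
  simp [christoffelFirst]

theorem fderiv_apply_apply_eq {G : H → E →L[ℝ] E →L[ℝ] F} {y : H} (hG : DifferentiableAt ℝ G y)
    (w : H) (u v : E) : fderiv ℝ G y w u v = fderiv ℝ (fun z ↦ G z u v) y w := by
  have h1 : HasFDerivAt (fun z ↦ G z u v) _ y :=
    (hG.hasFDerivAt.clm_apply (hasFDerivAt_const u y)).clm_apply (hasFDerivAt_const v y)
  rw [h1.fderiv]
  simp

theorem DifferentiableAt.sub_smulRight_self {G : H → E →L[ℝ] E →L[ℝ] ℝ} {d : H → E →L[ℝ] ℝ}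
    {y : H} (hG : DifferentiableAt ℝ G y) (hd : DifferentiableAt ℝ d y) :
    DifferentiableAt ℝ (fun z ↦ G z - (d z).smulRight (d z)) y := by
  have hsq : ContDiff ℝ 1 (fun L : E →L[ℝ] ℝ ↦ L.smulRight L) := contDiff_id.smulRight contDiff_id
  exact DifferentiableAt.fun_sub hG
    ((hsq.differentiable (by norm_num)).differentiableAt.comp y hd)

/-- The Christoffel symbols of the first kind of the form `G - df ⊗ df`. -/
theorem christoffelFirst_deformed {G K : E → E →L[ℝ] E →L[ℝ] ℝ} {f : E → ℝ} {y : E}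
    (hG : DifferentiableAt ℝ G y) (hf : ContDiffAt ℝ 2 f y)
    (hK : K =ᶠ[𝓝 y] fun z ↦ G z - (fderiv ℝ f z).smulRight (fderiv ℝ f z)) (u v : E) :
    christoffelFirst K y u v
      = christoffelFirst G y u v - fderiv ℝ (fderiv ℝ f) y u v • fderiv ℝ f y := by
  have hd : DifferentiableAt ℝ (fderiv ℝ f) y :=
    (hf.fderiv_right (m := 1) (by norm_num)).differentiableAt (by norm_num)
  have hsymm : ∀ a b, fderiv ℝ (fderiv ℝ f) y a b = fderiv ℝ (fderiv ℝ f) y b a :=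
    fun a b ↦ hf.isSymmSndFDerivAt (by simp) a b
  have hD : ∀ a b c, fderiv ℝ K y a b c = fderiv ℝ G y a b c
      - (fderiv ℝ (fderiv ℝ f) y a b * fderiv ℝ f y c
        + fderiv ℝ f y b * fderiv ℝ (fderiv ℝ f) y a c) := by
    intro a b c
    have hKd : DifferentiableAt ℝ K y := (hG.sub_smulRight_self hd).congr_of_eventuallyEq hK
    rw [fderiv_apply_apply_eq hKd]
    have he : (fun z ↦ K z b c) =ᶠ[𝓝 y] fun z ↦ G z b c - fderiv ℝ f z b * fderiv ℝ f z c := by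
      filter_upwards [hK] with z hz
      simp [hz]
    rw [he.fderiv_eq]
    have h1 : HasFDerivAt (fun z ↦ G z b c) _ y :=
      (hG.hasFDerivAt.clm_apply (hasFDerivAt_const b y)).clm_apply (hasFDerivAt_const c y)
    have h2 : HasFDerivAt (fun z ↦ fderiv ℝ f z b) _ y :=
      hd.hasFDerivAt.clm_apply (hasFDerivAt_const b y)
    have h3 : HasFDerivAt (fun z ↦ fderiv ℝ f z c) _ y :=
      hd.hasFDerivAt.clm_apply (hasFDerivAt_const c y)
    have h4 : HasFDerivAt (fun z ↦ G z b c - fderiv ℝ f z b * fderiv ℝ f z c) _ y :=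
      h1.sub (h2.mul h3)
    rw [h4.fderiv]
    simp
    ring
  ext w
  -- Once D²f is symmetric, the terms in D²f(u, w) and D²f(v, w) cancel and D²f(u, v) df(w) is left
  -- twice.
  rw [christoffelFirst_apply, sub_apply, christoffelFirst_apply, hD, hD, hD, hsymm v u, hsymm w u,
    hsymm w v]
  simp only [smul_apply, smul_eq_mul]
  ring

/-- The Christoffel symbols of the first kind of a pulled back form. -/
theorem christoffelFirst_pullback {G : E → E →L[ℝ] E →L[ℝ] ℝ} {K : F → F →L[ℝ] F →L[ℝ] ℝ}
    {φ : E → F} {y : E} (hG : DifferentiableAt ℝ G y) (hK : DifferentiableAt ℝ K (φ y))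
    (hKs : ∀ a b, K (φ y) a b = K (φ y) b a) (hφ : ContDiffAt ℝ 2 φ y)
    (hGK : ∀ᶠ z in 𝓝 y, ∀ a b, G z a b = K (φ z) (fderiv ℝ φ z a) (fderiv ℝ φ z b))
    (u v w : E) :
    christoffelFirst G y u v w
      = christoffelFirst K (φ y) (fderiv ℝ φ y u) (fderiv ℝ φ y v) (fderiv ℝ φ y w)
        + K (φ y) (fderiv ℝ (fderiv ℝ φ) y u v) (fderiv ℝ φ y w) := by
  have hd : DifferentiableAt ℝ (fderiv ℝ φ) y :=
    (hφ.fderiv_right (m := 1) (by norm_num)).differentiableAt (by norm_num)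
  have hsymm : ∀ a b, fderiv ℝ (fderiv ℝ φ) y a b = fderiv ℝ (fderiv ℝ φ) y b a :=
    fun a b ↦ hφ.isSymmSndFDerivAt (by simp) a b
  have hD : ∀ a b c, fderiv ℝ G y a b c
      = fderiv ℝ K (φ y) (fderiv ℝ φ y a) (fderiv ℝ φ y b) (fderiv ℝ φ y c)
        + K (φ y) (fderiv ℝ (fderiv ℝ φ) y a b) (fderiv ℝ φ y c)
        + K (φ y) (fderiv ℝ φ y b) (fderiv ℝ (fderiv ℝ φ) y a c) := by
    intro a b c
    rw [fderiv_apply_apply_eq hG]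
    have he : (fun z ↦ G z b c) =ᶠ[𝓝 y] fun z ↦ K (φ z) (fderiv ℝ φ z b) (fderiv ℝ φ z c) := by
      filter_upwards [hGK] with z hz using hz b c
    rw [he.fderiv_eq]
    have h1 : HasFDerivAt (fun z ↦ K (φ z)) _ y :=
      hK.hasFDerivAt.comp y (hφ.differentiableAt (by norm_num)).hasFDerivAt
    have h2 : HasFDerivAt (fun z ↦ fderiv ℝ φ z b) _ y :=
      hd.hasFDerivAt.clm_apply (hasFDerivAt_const b y)
    have h3 : HasFDerivAt (fun z ↦ fderiv ℝ φ z c) _ y :=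
      hd.hasFDerivAt.clm_apply (hasFDerivAt_const c y)
    have h4 : HasFDerivAt (fun z ↦ K (φ z) (fderiv ℝ φ z b) (fderiv ℝ φ z c)) _ y :=
      (h1.clm_apply h2).clm_apply h3
    rw [h4.fderiv]
    simp
    ring
  -- The same cancellation, now also using the symmetry of K, leaves twice K(D²φ(u, v), dφ(w)).
  rw [christoffelFirst_apply, christoffelFirst_apply, hD, hD, hD, hsymm v u, hsymm w u,
    hsymm w v, hKs (fderiv ℝ φ y u), hKs (fderiv ℝ φ y v)]
  ring

/-- Composing with the differential of an isometry `φ : (E, K₀) → (F, K)` turns the difference of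
the Christoffel symbols of `K₀` and `G` into the second fundamental form of `φ : (E, G) → (F, K)`,
here tested against the vectors in the image of the differential. -/
theorem apply_localSecondFundamentalForm [FiniteDimensional ℝ E] [FiniteDimensional ℝ F]
    {G K₀ : E → E →L[ℝ] E →L[ℝ] ℝ} {K : F → F →L[ℝ] F →L[ℝ] ℝ}
    {φ : E → F} {y : E} (hK₀ : DifferentiableAt ℝ K₀ y) (hK : DifferentiableAt ℝ K (φ y))
    (hKs : ∀ a b, K (φ y) a b = K (φ y) b a) (hKpos : ∀ v, v ≠ 0 → 0 < K (φ y) v v)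
    (hφ : ContDiffAt ℝ 2 φ y)
    (hKK : ∀ᶠ z in 𝓝 y, ∀ a b, K₀ z a b = K (φ z) (fderiv ℝ φ z a) (fderiv ℝ φ z b))
    (u v w : E) :
    K (φ y) (localSecondFundamentalForm G K φ y u v) (fderiv ℝ φ y w)
      = christoffelFirst K₀ y u v w - K₀ y (christoffel G y u v) w := by
  rw [christoffelFirst_pullback hK₀ hK hKs hφ hKK, hKK.self_of_nhds, localSecondFundamentalForm,
    map_sub, map_add, apply_christoffel hKpos]
  simp only [sub_apply, add_apply]
  ring

/-- The second fundamental form of the isometry `φ`, seen as a map from `G` to the pull-back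
`G - df ⊗ df`, is determined by the Hessian of `f`. -/
theorem apply_localSecondFundamentalForm_deformed [FiniteDimensional ℝ E] [FiniteDimensional ℝ F]
    {G K₀ : E → E →L[ℝ] E →L[ℝ] ℝ} {K : F → F →L[ℝ] F →L[ℝ] ℝ} {f : E → ℝ}
    {φ : E → F} {y : E} (hG : DifferentiableAt ℝ G y) (hGpos : ∀ v, v ≠ 0 → 0 < G y v v)
    (hf : ContDiffAt ℝ 2 f y) (hK : DifferentiableAt ℝ K (φ y))
    (hKs : ∀ a b, K (φ y) a b = K (φ y) b a) (hKpos : ∀ v, v ≠ 0 → 0 < K (φ y) v v)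
    (hφ : ContDiffAt ℝ 2 φ y)
    (hK₀ : K₀ =ᶠ[𝓝 y] fun z ↦ G z - (fderiv ℝ f z).smulRight (fderiv ℝ f z))
    (hKK : ∀ᶠ z in 𝓝 y, ∀ a b, K₀ z a b = K (φ z) (fderiv ℝ φ z a) (fderiv ℝ φ z b))
    (u v w : E) :
    K (φ y) (localSecondFundamentalForm G K φ y u v) (fderiv ℝ φ y w)
      = - localHessian G f y u v * fderiv ℝ f y w := by
  have hd : DifferentiableAt ℝ (fderiv ℝ f) y :=
    (hf.fderiv_right (m := 1) (by norm_num)).differentiableAt (by norm_num)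
  have hK₀d : DifferentiableAt ℝ K₀ y :=
    (hG.sub_smulRight_self hd).congr_of_eventuallyEq hK₀
  -- Evaluating `K₀` on the Christoffel vector of `G` produces df(Γ(u, v)) df(w), which completes
  -- D²f(u, v) to the Hessian.
  rw [apply_localSecondFundamentalForm hK₀d hK hKs hKpos hφ hKK,
    christoffelFirst_deformed hG hf hK₀, hK₀.self_of_nhds, localHessian]
  simp only [sub_apply, smul_apply, smul_eq_mul, ContinuousLinearMap.smulRight_apply,
    apply_christoffel hGpos]
  ring

/-! ### Metric traces and continuity of the Laplacian -/

/-- Pairing with a fixed vector is linear, so this carries the pointwise formula for the second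
fundamental form over to its trace. -/
theorem map_metricTrace [FiniteDimensional ℝ E] (G : E →L[ℝ] E →L[ℝ] ℝ) (B : E → E → F)
    (L : F →ₗ[ℝ] H) : L (metricTrace G B) = metricTrace G fun u v ↦ L (B u v) := by
  simp [metricTrace, map_sum]

/-- A kernel vector c of the Gram matrix gives v = ∑ c_l b_l with G(b_k, v) = 0 for all k, hence
G(v, v) = 0. -/
theorem det_gram_ne_zero [FiniteDimensional ℝ E] {G : E →L[ℝ] E →L[ℝ] ℝ}
    (hG : ∀ v, v ≠ 0 → 0 < G v v) {ι : Type*} [Fintype ι] [DecidableEq ι]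
    (b : Module.Basis ι ℝ E) : (Matrix.of fun k l ↦ G (b k) (b l)).det ≠ 0 := by
  intro h
  obtain ⟨c, hc, hcz⟩ := Matrix.exists_mulVec_eq_zero_iff.2 h
  have hne : ∑ l, c l • b l ≠ 0 := fun h0 ↦
    hc (funext fun i ↦ Fintype.linearIndependent_iff.1 b.linearIndependent c h0 i)
  have hz : ∀ k, G (b k) (∑ l, c l • b l) = 0 := by
    intro k
    have := congrFun hcz k
    simp only [Matrix.mulVec, dotProduct, Matrix.of_apply, Pi.zero_apply] at this
    rw [map_sum, ← this]
    exact Finset.sum_congr rfl fun l _ ↦ by simp [mul_comm]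
  have h1 := hG _ hne
  have h2 : ∀ t, G (∑ l, c l • b l) t = ∑ k, c k * G (b k) t := fun t ↦ by simp
  rw [h2] at h1
  simp only [hz, mul_zero, Finset.sum_const_zero, lt_irrefl] at h1

theorem ContinuousAt.matrix_inv_of_det_ne_zero {X ι : Type*} [TopologicalSpace X] [Fintype ι]
    [DecidableEq ι] {A : X → Matrix ι ι ℝ} {y : X} (hA : ContinuousAt A y)
    (hdet : (A y).det ≠ 0) : ContinuousAt (fun z ↦ (A z)⁻¹) y := by
  have h1 : ContinuousAt (fun z ↦ (A z).det) y :=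
    (Continuous.matrix_det (A := fun B : Matrix ι ι ℝ ↦ B) continuous_id).continuousAt.comp hA
  have h2 : ContinuousAt (fun z ↦ (A z).adjugate) y :=
    (Continuous.matrix_adjugate (A := fun B : Matrix ι ι ℝ ↦ B) continuous_id).continuousAt.comp hA
  -- The inverse is the adjugate divided by the determinant.
  simp only [Matrix.inv_def, Ring.inverse_eq_inv']
  exact (h1.inv₀ hdet).smul h2

theorem continuousAt_metricTrace [FiniteDimensional ℝ E] {X : Type*} [TopologicalSpace X]
    {G : X → E →L[ℝ] E →L[ℝ] ℝ} {B : X → E → E → F} {y : X} (hG : ContinuousAt G y)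
    (hGpos : ∀ v, v ≠ 0 → 0 < G y v v) (hB : ∀ u v, ContinuousAt (fun z ↦ B z u v) y) :
    ContinuousAt (fun z ↦ metricTrace (G z) (B z)) y := by
  have hM : ContinuousAt (fun z ↦ Matrix.of fun k l ↦
      G z (Module.finBasis ℝ E k) (Module.finBasis ℝ E l)) y := by
    refine continuousAt_pi.2 fun k ↦ continuousAt_pi.2 fun l ↦ ?_
    exact (hG.clm_apply continuousAt_const).clm_apply continuousAt_const
  have hinv : ContinuousAt (fun z ↦ (Matrix.of fun k l ↦
      G z (Module.finBasis ℝ E k) (Module.finBasis ℝ E l))⁻¹) y :=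
    hM.matrix_inv_of_det_ne_zero (det_gram_ne_zero hGpos _)
  refine tendsto_finsetSum _ fun i _ ↦ tendsto_finsetSum _ fun j _ ↦ ?_
  exact ContinuousAt.smul (continuousAt_pi.1 (continuousAt_pi.1 hinv i) j) (hB _ _)

theorem continuousAt_christoffel [FiniteDimensional ℝ E] {G : E → E →L[ℝ] E →L[ℝ] ℝ} {y : E}
    (hG : ContDiffAt ℝ 1 G y) (hGpos : ∀ v, v ≠ 0 → 0 < G y v v) (u v : E) :
    ContinuousAt (fun z ↦ christoffel G z u v) y := by
  have hd : ContinuousAt (fderiv ℝ G) y := (hG.fderiv_right (m := 0) (by norm_num)).continuousAt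
  obtain ⟨L, hL⟩ := exists_equiv_dual_of_pos hGpos
  have hinv : ContinuousAt (fun z ↦ (G z).inverse) y := by
    have h := (contDiffAt_map_inverse (𝕜 := ℝ) (n := 0) L).continuousAt
    rw [hL] at h
    exact h.comp (f := G) hG.continuousAt
  refine hinv.clm_apply ?_
  -- The flips become compositions with evaluation maps, which are visibly continuous in A.
  have hflip : ∀ A : E →L[ℝ] E →L[ℝ] E →L[ℝ] ℝ, (A.flip u).flip v
      = (ContinuousLinearMap.apply ℝ ℝ v).comp
        ((ContinuousLinearMap.apply ℝ (E →L[ℝ] ℝ) u).comp A) := by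
    intro A
    ext w
    simp
  simp only [christoffelFirst, hflip]
  have h1 : ∀ a b : E, ContinuousAt (fun z ↦ fderiv ℝ G z a b) y := fun a b ↦
    (hd.clm_apply continuousAt_const).clm_apply continuousAt_const
  have h2 : ContinuousAt (fun z ↦ (ContinuousLinearMap.apply ℝ ℝ v).comp
      ((ContinuousLinearMap.apply ℝ (E →L[ℝ] ℝ) u).comp (fderiv ℝ G z))) y :=
    continuousAt_const.clm_comp (continuousAt_const.clm_comp hd)
  exact (((h1 u v).add (h1 v u)).sub h2).const_smul (1 / 2 : ℝ)

theorem continuousAt_localHessian [FiniteDimensional ℝ E] {G : E → E →L[ℝ] E →L[ℝ] ℝ}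
    {f : E → ℝ} {y : E} (hG : ContDiffAt ℝ 1 G y) (hGpos : ∀ v, v ≠ 0 → 0 < G y v v)
    (hf : ContDiffAt ℝ 2 f y) (u v : E) :
    ContinuousAt (fun z ↦ localHessian G f z u v) y := by
  have hd := hf.fderiv_right (m := 1) (by norm_num)
  have hdd := (hd.fderiv_right (m := 0) (by norm_num)).continuousAt
  exact ((hdd.clm_apply continuousAt_const).clm_apply continuousAt_const).sub
    (hd.continuousAt.clm_apply (continuousAt_christoffel hG hGpos u v))

/-- If `trace_G (Hess f) • df` vanishes near a point, then `trace_G (Hess f)` vanishes there. -/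
theorem metricTrace_localHessian_eq_zero [FiniteDimensional ℝ E] {G : E → E →L[ℝ] E →L[ℝ] ℝ}
    {f : E → ℝ} {y : E} (hG : ContDiffAt ℝ 1 G y) (hGpos : ∀ v, v ≠ 0 → 0 < G y v v)
    (hf : ContDiffAt ℝ 2 f y)
    (h : ∀ᶠ z in 𝓝 y, metricTrace (G z) (localHessian G f z) = 0 ∨ fderiv ℝ f z = 0) :
    metricTrace (G y) (localHessian G f y) = 0 := by
  by_contra hne
  have hc : ContinuousAt (fun z ↦ metricTrace (G z) (localHessian G f z)) y :=
    continuousAt_metricTrace hG.continuousAt hGpos (continuousAt_localHessian hG hGpos hf)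
  -- Vanishing on a neighbourhood, not just at y, is what also kills the second derivative at y.
  have hz : fderiv ℝ f =ᶠ[𝓝 y] fun _ ↦ 0 := by
    filter_upwards [h, hc.eventually_ne hne] with z hz hz' using hz.resolve_left hz'
  apply hne
  simp [metricTrace, localHessian, hz.fderiv_eq, hz.self_of_nhds]

end Local

/-! ### Metrics, functions and the tension field read in charts -/

section Charts

set_option maxSynthPendingDepth 3

variable {E : Type*} [NormedAddCommGroup E] [NormedSpace ℝ E]
  {M : Type*} [TopologicalSpace M] [ChartedSpace E M]
  {e e' : OpenPartialHomeomorph M E}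

theorem contMDiffAt_chart_symm (he : e ∈ IsManifold.maximalAtlas 𝓘(ℝ, E) ∞ M) {y : E}
    (hy : y ∈ e.target) : ContMDiffAt 𝓘(ℝ, E) 𝓘(ℝ, E) ∞ e.symm y :=
  (contMDiffOn_symm_of_mem_maximalAtlas he).contMDiffAt (e.open_target.mem_nhds hy)

theorem contMDiffAt_chart (he : e ∈ IsManifold.maximalAtlas 𝓘(ℝ, E) ∞ M) {x : M}
    (hx : x ∈ e.source) : ContMDiffAt 𝓘(ℝ, E) 𝓘(ℝ, E) ∞ e x :=
  (contMDiffOn_of_mem_maximalAtlas he).contMDiffAt (e.open_source.mem_nhds hx)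

/-- The chain rule for `e ∘ e.symm`, which is the identity near y, exhibits a left inverse. -/
theorem injective_mfderiv_chart_symm (he : e ∈ IsManifold.maximalAtlas 𝓘(ℝ, E) ∞ M) {y : E}
    (hy : y ∈ e.target) : Function.Injective (mfderiv 𝓘(ℝ, E) 𝓘(ℝ, E) e.symm y) := by
  have h1 : HasMFDerivAt 𝓘(ℝ, E) 𝓘(ℝ, E) e.symm y _ :=
    ((contMDiffAt_chart_symm he hy).mdifferentiableAt (by simp)).hasMFDerivAt
  have h2 : HasMFDerivAt 𝓘(ℝ, E) 𝓘(ℝ, E) e (e.symm y) _ :=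
    ((contMDiffAt_chart he (e.map_target hy)).mdifferentiableAt (by simp)).hasMFDerivAt
  have h3 := h2.comp y h1
  have h4 : HasMFDerivAt 𝓘(ℝ, E) 𝓘(ℝ, E) (e ∘ e.symm) y
      (ContinuousLinearMap.id ℝ (TangentSpace 𝓘(ℝ, E) y)) := by
    refine (hasMFDerivAt_id y).congr_of_eventuallyEq ?_
    filter_upwards [e.open_target.mem_nhds hy] with z hz using e.right_inv hz
  have h5 := hasMFDerivAt_unique h3 h4
  intro a b hab
  have ha := DFunLike.congr_fun h5 a
  have hb := DFunLike.congr_fun h5 b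
  exact ha.symm.trans ((congrArg (mfderiv 𝓘(ℝ, E) 𝓘(ℝ, E) e (e.symm y)) hab).trans hb)

theorem contDiffAt_transition (he : e ∈ IsManifold.maximalAtlas 𝓘(ℝ, E) ∞ M)
    (he' : e' ∈ IsManifold.maximalAtlas 𝓘(ℝ, E) ∞ M) {y : E} (hy : y ∈ e.target)
    (hy' : e.symm y ∈ e'.source) : ContDiffAt ℝ ∞ (e' ∘ e.symm) y := by
  rw [← contMDiffAt_iff_contDiffAt]
  exact (contMDiffAt_chart he' hy').comp y (contMDiffAt_chart_symm he hy)

theorem mfderiv_chart_symm_transition (he : e ∈ IsManifold.maximalAtlas 𝓘(ℝ, E) ∞ M)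
    (he' : e' ∈ IsManifold.maximalAtlas 𝓘(ℝ, E) ∞ M) {y : E} (hy : y ∈ e.target)
    (hy' : e.symm y ∈ e'.source) :
    (mfderiv 𝓘(ℝ, E) 𝓘(ℝ, E) e.symm y : E →L[ℝ] E)
      = (mfderiv 𝓘(ℝ, E) 𝓘(ℝ, E) e'.symm ((e' ∘ e.symm) y) : E →L[ℝ] E).comp
        (fderiv ℝ (e' ∘ e.symm) y) := by
  have h1 : HasMFDerivAt 𝓘(ℝ, E) 𝓘(ℝ, E) (e' ∘ e.symm) y (fderiv ℝ (e' ∘ e.symm) y) :=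
    ((contDiffAt_transition he he' hy hy').differentiableAt (by simp)).hasFDerivAt.hasMFDerivAt
  have h2 : HasMFDerivAt 𝓘(ℝ, E) 𝓘(ℝ, E) e'.symm ((e' ∘ e.symm) y) _ :=
    ((contMDiffAt_chart_symm he' (e'.map_source hy')).mdifferentiableAt (by simp)).hasMFDerivAt
  have h3 := h2.comp y h1
  have h4 : e'.symm ∘ (e' ∘ e.symm) =ᶠ[𝓝 y] e.symm := by
    filter_upwards [(e.symm.continuousAt hy).preimage_mem_nhds (e'.open_source.mem_nhds hy')]
      with z hz using e'.left_inv hz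
  exact h4.mfderiv_eq.symm.trans h3.mfderiv

theorem injective_fderiv_transition (he : e ∈ IsManifold.maximalAtlas 𝓘(ℝ, E) ∞ M)
    (he' : e' ∈ IsManifold.maximalAtlas 𝓘(ℝ, E) ∞ M) {y : E} (hy : y ∈ e.target)
    (hy' : e.symm y ∈ e'.source) : Function.Injective (fderiv ℝ (e' ∘ e.symm) y) := by
  have h : Function.Injective (mfderiv 𝓘(ℝ, E) 𝓘(ℝ, E) e.symm y : E →L[ℝ] E) :=
    injective_mfderiv_chart_symm he hy
  rw [mfderiv_chart_symm_transition he he' hy hy'] at h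
  exact Function.Injective.of_comp h

theorem contDiffAt_comp_chart_symm (f : C^∞⟮𝓘(ℝ, E), M; 𝓘(ℝ, ℝ), ℝ⟯)
    (he : e ∈ IsManifold.maximalAtlas 𝓘(ℝ, E) ∞ M) {y : E} (hy : y ∈ e.target) :
    ContDiffAt ℝ ∞ (f ∘ e.symm) y := by
  rw [← contMDiffAt_iff_contDiffAt]
  exact f.contMDiff.contMDiffAt.comp y (contMDiffAt_chart_symm he hy)

theorem fderiv_comp_chart_symm (f : C^∞⟮𝓘(ℝ, E), M; 𝓘(ℝ, ℝ), ℝ⟯)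
    (he : e ∈ IsManifold.maximalAtlas 𝓘(ℝ, E) ∞ M) {y : E} (hy : y ∈ e.target) (u : E) :
    fderiv ℝ (f ∘ e.symm) y u
      = differential f (e.symm y) (mfderiv 𝓘(ℝ, E) 𝓘(ℝ, E) e.symm y u) := by
  have h := mfderiv_comp y (f.contMDiff.contMDiffAt.mdifferentiableAt (by simp))
    ((contMDiffAt_chart_symm he hy).mdifferentiableAt (by simp))
  rw [mfderiv_eq_fderiv] at h
  exact DFunLike.congr_fun h u

variable [IsManifold 𝓘(ℝ, E) ∞ M]

theorem metricInChart_symm (g : RiemMetric E M) (y u v : E) :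
    metricInChart g e y u v = metricInChart g e y v u :=
  g.symm (e.symm y) (mfderiv 𝓘(ℝ, E) 𝓘(ℝ, E) e.symm y u) (mfderiv 𝓘(ℝ, E) 𝓘(ℝ, E) e.symm y v)

theorem metricInChart_pos (g : RiemMetric E M) (he : e ∈ IsManifold.maximalAtlas 𝓘(ℝ, E) ∞ M)
    {y : E} (hy : y ∈ e.target) (v : E) (hv : v ≠ 0) : 0 < metricInChart g e y v v := by
  refine g.pos _ _ fun h ↦ hv ?_
  exact injective_mfderiv_chart_symm he hy (h.trans (map_zero _).symm)

theorem contDiffOn_metricInChart [FiniteDimensional ℝ E] (g : RiemMetric E M)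
    (he : e ∈ IsManifold.maximalAtlas 𝓘(ℝ, E) ∞ M) :
    ContDiffOn ℝ ∞ (metricInChart g e) e.target := by
  refine contDiffOn_clm_apply.2 fun u ↦ contDiffOn_clm_apply.2 fun v ↦ ?_
  rw [← contMDiffOn_iff_contDiffOn]
  have hs := contMDiffOn_symm_of_mem_maximalAtlas he
  -- The coordinate field of u is the tangent map of `e.symm` applied to a constant field, so it is
  -- smooth along `e.symm`; the coefficients of the metric are g evaluated on two such fields.
  have hT : ∀ u : E, ContMDiffOn 𝓘(ℝ, E) (𝓘(ℝ, E).prod 𝓘(ℝ, E)) ∞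
      (fun y ↦ TotalSpace.mk' E (E := (TangentSpace 𝓘(ℝ, E) : M → Type _)) (e.symm y)
        (mfderiv 𝓘(ℝ, E) 𝓘(ℝ, E) e.symm y u)) e.target := by
    intro u
    have h1 := hs.contMDiffOn_tangentMapWithin (m := ∞) (by simp) e.open_target.uniqueMDiffOn
    have h2 : ContMDiff 𝓘(ℝ, E) (𝓘(ℝ, E).prod 𝓘(ℝ, E)) ∞
        (fun y : E ↦ TotalSpace.mk' E (E := (TangentSpace 𝓘(ℝ, E) : E → Type _)) y u) := by
      exact contMDiff_vectorSpace_iff_contDiff.2 contDiff_const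
    refine (h1.comp (h2.contMDiffOn (s := e.target)) fun y hy ↦ hy).congr fun y hy ↦ ?_
    simp [tangentMapWithin, mfderivWithin_of_isOpen e.open_target hy]
  have hg : ContMDiffOn 𝓘(ℝ, E) (𝓘(ℝ, E).prod 𝓘(ℝ, E →L[ℝ] E →L[ℝ] ℝ)) ∞
      (fun y ↦ TotalSpace.mk' (E →L[ℝ] E →L[ℝ] ℝ)
        (E := fun x : M ↦ TangentSpace 𝓘(ℝ, E) x →L[ℝ] TangentSpace 𝓘(ℝ, E) x →L[ℝ] ℝ)
        (e.symm y) (g.inner (e.symm y))) e.target :=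
    g.contMDiff.comp_contMDiffOn hs
  have h := ContMDiffOn.clm_bundle_apply₂ (F₁ := E) (F₂ := E) (F₃ := ℝ)
    (E₃ := fun _ : M ↦ ℝ) hg (hT u) (hT v)
  intro y hy
  have h' := h y hy
  rw [contMDiffWithinAt_totalSpace] at h'
  exact h'.2

theorem metricInChart_transition (g : RiemMetric E M)
    (he : e ∈ IsManifold.maximalAtlas 𝓘(ℝ, E) ∞ M)
    (he' : e' ∈ IsManifold.maximalAtlas 𝓘(ℝ, E) ∞ M) {y : E} (hy : y ∈ e.target)
    (hy' : e.symm y ∈ e'.source) (u v : E) :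
    metricInChart g e y u v = metricInChart g e' ((e' ∘ e.symm) y)
      (fderiv ℝ (e' ∘ e.symm) y u) (fderiv ℝ (e' ∘ e.symm) y v) := by
  -- The base points `e.symm y` and `e'.symm (e' (e.symm y))` are only propositionally equal;
  -- reading all tangent spaces as E permits the substitution.
  have hinner : ∀ x x' : M, x = x' → ∀ A : E →L[ℝ] E,
      (g.inner x : E →L[ℝ] E →L[ℝ] ℝ) (A u) (A v)
        = (g.inner x' : E →L[ℝ] E →L[ℝ] ℝ) (A u) (A v) := by
    rintro x _ rfl A
    rfl
  have h1 : metricInChart g e y u v = (g.inner (e.symm y) : E →L[ℝ] E →L[ℝ] ℝ)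
      ((mfderiv 𝓘(ℝ, E) 𝓘(ℝ, E) e.symm y : E →L[ℝ] E) u)
      ((mfderiv 𝓘(ℝ, E) 𝓘(ℝ, E) e.symm y : E →L[ℝ] E) v) := rfl
  rw [h1, mfderiv_chart_symm_transition he he' hy hy']
  exact hinner _ (e'.symm ((e' ∘ e.symm) y)) (e'.left_inv hy').symm
    ((mfderiv 𝓘(ℝ, E) 𝓘(ℝ, E) e'.symm ((e' ∘ e.symm) y) : E →L[ℝ] E).comp
      (fderiv ℝ (e' ∘ e.symm) y))

theorem metricInChart_deformedMetric [FiniteDimensional ℝ E] (g : RiemMetric E M)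
    (f : C^∞⟮𝓘(ℝ, E), M; 𝓘(ℝ, ℝ), ℝ⟯) (hf : ∀ x, gradientNorm g f x < 1)
    (he : e ∈ IsManifold.maximalAtlas 𝓘(ℝ, E) ∞ M) {y : E} (hy : y ∈ e.target) :
    metricInChart (deformedMetric g f hf) e y
      = metricInChart g e y
        - (fderiv ℝ (f ∘ e.symm) y).smulRight (fderiv ℝ (f ∘ e.symm) y) := by
  ext u v
  rw [sub_apply, sub_apply, ContinuousLinearMap.smulRight_apply, smul_apply, smul_eq_mul,
    fderiv_comp_chart_symm f he hy, fderiv_comp_chart_symm f he hy]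
  rfl

/-- The tension field of the identity map from `g` to `g - df ⊗ df`: its inner product with `w` is
`- Δf • df(w)`. -/
theorem metricInChart_tensionField_id [FiniteDimensional ℝ E] (g : RiemMetric E M)
    (f : C^∞⟮𝓘(ℝ, E), M; 𝓘(ℝ, ℝ), ℝ⟯) (hf : ∀ x, gradientNorm g f x < 1)
    (he : e ∈ IsManifold.maximalAtlas 𝓘(ℝ, E) ∞ M)
    (he' : e' ∈ IsManifold.maximalAtlas 𝓘(ℝ, E) ∞ M) {x : M} (hx : x ∈ e.source)
    (hx' : x ∈ e'.source) (w : E) :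
    metricInChart (deformedMetric g f hf) e' (e' x)
        (tensionField g (deformedMetric g f hf) id e e' x) (fderiv ℝ (e' ∘ e.symm) (e x) w)
      = - laplaceBeltrami g f e x * fderiv ℝ (f ∘ e.symm) (e x) w := by
  have hy := e.map_source hx
  have hxy : e.symm (e x) = x := e.left_inv hx
  have hφ : (e' ∘ e.symm) (e x) = e' x := congrArg e' hxy
  have hy' : e.symm (e x) ∈ e'.source := hxy.symm ▸ hx'
  have hdiff : ∀ (h : RiemMetric E M) (c : OpenPartialHomeomorph M E),
      c ∈ IsManifold.maximalAtlas 𝓘(ℝ, E) ∞ M → ∀ z ∈ c.target,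
      DifferentiableAt ℝ (metricInChart h c) z := fun h c hc z hz ↦
    ((contDiffOn_metricInChart h hc).contDiffAt (c.open_target.mem_nhds hz)).differentiableAt
      (by simp)
  have hφt : (e' ∘ e.symm) (e x) ∈ e'.target := e'.map_source hy'
  have hnear : ∀ᶠ z in 𝓝 (e x), z ∈ e.target := e.open_target.mem_nhds hy
  have hnear' : ∀ᶠ z in 𝓝 (e x), e.symm z ∈ e'.source :=
    (e.symm.continuousAt hy).preimage_mem_nhds (e'.open_source.mem_nhds hy')
  have key := apply_localSecondFundamentalForm_deformed (w := w) (hdiff g e he _ hy)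
    (metricInChart_pos g he hy)
    ((contDiffAt_comp_chart_symm f he hy).of_le (by norm_cast))
    (hdiff (deformedMetric g f hf) e' he' _ hφt)
    (metricInChart_symm (deformedMetric g f hf) _)
    (metricInChart_pos (deformedMetric g f hf) he' hφt)
    ((contDiffAt_transition he he' hy hy').of_le (by norm_cast))
    (hnear.mono fun z hz ↦ metricInChart_deformedMetric g f hf he hz)
    (by
      filter_upwards [hnear, hnear'] with z hz hz' a b
      exact metricInChart_transition (deformedMetric g f hf) he he' hz hz' a b)
  rw [hφ] at key
  -- Both sides are put as a linear map applied to a metric trace, so that the comparison reduces to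
  -- each pair u, v.
  have hL : ∀ t : E, metricInChart (deformedMetric g f hf) e' (e' x) t
      (fderiv ℝ (e' ∘ e.symm) (e x) w) = ((metricInChart (deformedMetric g f hf) e' (e' x)).flip
        (fderiv ℝ (e' ∘ e.symm) (e x) w) : E →ₗ[ℝ] ℝ) t := fun _ ↦ rfl
  rw [hL, tensionField, map_metricTrace, laplaceBeltrami]
  have hR : ∀ t : ℝ, - t * fderiv ℝ (f ∘ e.symm) (e x) w
      = LinearMap.mulRight ℝ (- fderiv ℝ (f ∘ e.symm) (e x) w) t := fun t ↦ by simp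
  rw [hR, map_metricTrace]
  refine congrArg _ (funext fun u ↦ funext fun v ↦ ?_)
  rw [← hR, ← hL]
  exact key u v

end Charts

/-! ### The equivalence -/

theorem mainTheorem2 {E : Type*} [NormedAddCommGroup E] [NormedSpace ℝ E] [FiniteDimensional ℝ E]
    {M : Type*} [TopologicalSpace M] [ChartedSpace E M] [IsManifold 𝓘(ℝ, E) ∞ M]
    (g : RiemMetric E M) (f : C^∞⟮𝓘(ℝ, E), M; 𝓘(ℝ, ℝ), ℝ⟯)
    (hf : ∀ x, gradientNorm g f x < 1) :
    IsHarmonicMap g (deformedMetric g f hf)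
        (ContMDiffMap.id : C^∞⟮𝓘(ℝ, E), M; 𝓘(ℝ, E), M⟯) ↔
      IsHarmonicFunction g f := by
  constructor
  · intro h e he x hx
    have hy := e.map_source hx
    refine metricTrace_localHessian_eq_zero
      (((contDiffOn_metricInChart g he).contDiffAt (e.open_target.mem_nhds hy)).of_le
        (by norm_cast)) (metricInChart_pos g he hy)
      ((contDiffAt_comp_chart_symm f he hy).of_le (by norm_cast)) ?_
    filter_upwards [e.open_target.mem_nhds hy] with z hz
    have hzs := e.map_target hz
    -- For this direction it is enough to use one chart on both sides.
    have hτ : tensionField g (deformedMetric g f hf) id e e (e.symm z) = 0 :=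
      h e he e he _ hzs hzs
    by_contra! hne
    refine hne.2 (ContinuousLinearMap.ext fun w ↦ ?_)
    have key := metricInChart_tensionField_id g f hf he he hzs hzs w
    rw [hτ, map_zero, laplaceBeltrami, e.right_inv hz] at key
    exact (mul_eq_zero.1 key.symm).resolve_left (neg_ne_zero.2 hne.1)
  · intro h e he e' he' x hx hx'
    change x ∈ e'.source at hx'
    change tensionField g (deformedMetric g f hf) id e e' x = 0
    have hy' : e.symm (e x) ∈ e'.source := (e.left_inv hx).symm ▸ hx'
    have hsurj : Function.Surjective (fderiv ℝ (e' ∘ e.symm) (e x)) :=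
      LinearMap.surjective_of_injective
        (f := (fderiv ℝ (e' ∘ e.symm) (e x) : E →ₗ[ℝ] E))
        (injective_fderiv_transition he he' (e.map_source hx) hy')
    -- Choosing w with dφ(w) = τ turns the formula into g̃(τ, τ) = 0.
    obtain ⟨w, hw⟩ := hsurj (tensionField g (deformedMetric g f hf) id e e' x)
    have key := metricInChart_tensionField_id g f hf he he' hx hx' w
    rw [h e he x hx, hw, neg_zero, zero_mul] at key
    by_contra hne
    exact (metricInChart_pos (deformedMetric g f hf) he' (e'.map_source hx') _ hne).ne' key
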